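/- For an integer $n\ge 0$ let $[n]=\{1,\dots,n\}$, and order the alphabet $[n]\times[n]$ lexicographically; order the words over it (the elements of the free monoid $([n]\times[n])^*$) lexicographically as well. A nonempty word is a *Lyndon word* if it is prime (not a power $u^r$, $r\ge2$, of another word $u$) and is minimal among its cyclic rearrangements. A word $(i_1,j_1)\cdots(i_d,j_d)$ is *connected* if $j_r=i_{r+1}$ for $r=1,\dots,d-1$. Let $\mathbb H$ be the real quaternions and $E_{rs}$ the matrix units in $\mathrm{Mat}(2m,\mathbb H)$. **Proposition.** For every $m$ there is $\varepsilon>0$, depending only on $m$, such that for every quaternionic matrix $A=(a_{rs})\in\mathrm{Mat}(2m,\mathbb H)$ with $|a_{rs}|<\varepsilon$ for all $r,s$, $$I_{2m}-A=\prod^{<}_{l=(i_1,j_1)\cdots(i_d,j_d)}\bigl(I_{2m}-a_{i_1j_1}a_{i_2j_2}\cdots a_{i_dj_d}\,E_{i_1j_d}\bigr),$$ where $l$ runs over all connected Lyndon words over $[2m]\times[2m]$ and $\prod^{<}$ means that the factors are multiplied from left to right in increasing order of $l$. The infinite product is understood as the entrywise limit of the finite increasingly ordered products over finite sets $F$ of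 connected Lyndon words, as $F$ increases along the directed set of all such finite sets; in particular it converges. -/

import Mathlib

open Filter Topology
open scoped Quaternion

/-- A word over a linearly ordered alphabet is a Lyndon word if it is nonempty, prime (not a power
`u ^ r` of a word `u` with `r ≥ 2`), and minimal, for the lexicographic order on words, among its
cyclic rearrangements. -/
def IsLyndon {X : Type*} [LinearOrder X] (w : List X) : Prop :=
  w ≠ [] ∧
  (∀ (u : List X) (r : ℕ), 2 ≤ r → w ≠ (List.replicate r u).flatten) ∧
  ∀ v : List X, v.IsRotated w → w ≤ v

/-- The alphabet `[n] × [n]` with the lexicographic order. -/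
abbrev PairAlphabet (n : ℕ) : Type := Fin n ×ₗ Fin n

/-- A word `(i₁, j₁) ⋯ (i_d, j_d)` is connected if `j_r = i_{r+1}` for `r = 1, …, d - 1`. -/
def IsConnectedWord {n : ℕ} (w : List (PairAlphabet n)) : Prop :=
  w.IsChain (fun p q => (ofLex p).2 = (ofLex q).1)

/-- The connected Lyndon words over `[n] × [n]`, with the lexicographic order on words. -/
abbrev ConnectedLyndonWord (n : ℕ) : Type :=
  {w : List (PairAlphabet n) // IsLyndon w ∧ IsConnectedWord w}

/-- `i₁` for the word `(i₁, j₁) ⋯ (i_d, j_d)`. -/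
def ConnectedLyndonWord.origin {n : ℕ} (l : ConnectedLyndonWord n) : Fin n :=
  (ofLex (l.1.head l.2.1.1)).1

/-- `j_d` for the word `(i₁, j₁) ⋯ (i_d, j_d)`. -/
def ConnectedLyndonWord.terminus {n : ℕ} (l : ConnectedLyndonWord n) : Fin n :=
  (ofLex (l.1.getLast l.2.1.1)).2

/-- The product of quaternions `a_{i₁ j₁} ⋯ a_{i_d j_d}`, in this order. -/
noncomputable def wordEntry {n : ℕ} (A : Matrix (Fin n) (Fin n) ℍ[ℝ])
    (w : List (PairAlphabet n)) : ℍ[ℝ] :=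
  (w.map (fun p => A (ofLex p).1 (ofLex p).2)).prod

/-- The factor `I - a_{i₁ j₁} ⋯ a_{i_d j_d} E_{i₁ j_d}`. -/
noncomputable def lyndonFactor {n : ℕ} (A : Matrix (Fin n) (Fin n) ℍ[ℝ])
    (l : ConnectedLyndonWord n) : Matrix (Fin n) (Fin n) ℍ[ℝ] :=
  1 - Matrix.single l.origin l.terminus (wordEntry A l.1)

/-- The infinite product of `f i` over a linearly ordered index set, the factors being multiplied
in increasing order of `i` from left to right, converges to `a`: the finite products over finite
sets `s` of indices, multiplied in increasing order, tend to `a` as `s` grows. This is the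
noncommutative, ordered analogue of `HasProd`. -/
def HasIncreasingProd {ι R : Type*} [LinearOrder ι] [Monoid R] [TopologicalSpace R]
    (f : ι → R) (a : R) : Prop :=
  Tendsto (fun s : Finset ι => ((s.sort (· ≤ ·)).map f).prod) atTop (𝓝 a)

section Lex

variable {X : Type*} [LinearOrder X]

theorem List.append_lt_append_iff_left' (a : List X) {b c : List X} :
    a ++ b < a ++ c ↔ b < c := by
  induction a with
  | nil => simp
  | cons x a ih => simp [ih]

theorem List.le_append_right' (a b : List X) : a ≤ a ++ b := by
  rcases b with _ | ⟨x, b⟩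
  · simp
  · have h := (List.append_lt_append_iff_left' a).2 (List.nil_lt_cons x b)
    rw [List.append_nil] at h
    exact h.le

theorem List.lt_append_of_ne_nil (a : List X) {b : List X} (hb : b ≠ []) : a < a ++ b :=
  lt_of_le_of_ne (List.le_append_right' a b) (by simpa using hb)

/-- A strict lexicographic inequality comes either from a proper prefix or from a first
difference, and the latter is insensitive to what follows. -/
theorem List.exists_append_or_forall_append_lt {a b : List X} (h : a < b) :
    (∃ c, c ≠ [] ∧ b = a ++ c) ∨ ∀ c d, a ++ c < b ++ d := by
  induction a generalizing b with
  | nil => exact Or.inl ⟨b, by rintro rfl; simp at h, rfl⟩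
  | cons x a ih =>
    rcases b with _ | ⟨y, b⟩
    · simp at h
    · rw [List.cons_lt_cons_iff] at h
      rcases h with h | ⟨rfl, h⟩
      · exact Or.inr fun c d => by simp [List.cons_lt_cons_iff, h]
      · rcases ih h with ⟨c, hc, rfl⟩ | h
        · exact Or.inl ⟨c, hc, rfl⟩
        · exact Or.inr fun c d => by simp [h]

theorem List.append_lt_append_of_length_le {a b : List X} (h : a < b)
    (hl : b.length ≤ a.length) (c d : List X) : a ++ c < b ++ d := by
  rcases List.exists_append_or_forall_append_lt h with ⟨e, he, rfl⟩ | h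
  · exact absurd (by simpa using hl) he
  · exact h c d

end Lex

/-- Two commuting nonempty words are powers of a common word. -/
theorem List.exists_replicate_flatten_of_append_comm {X : Type*} {u v : List X} (hu : u ≠ [])
    (hv : v ≠ []) (h : u ++ v = v ++ u) :
    ∃ (z : List X) (r s : ℕ), 1 ≤ r ∧ 1 ≤ s ∧ u = (List.replicate r z).flatten ∧
      v = (List.replicate s z).flatten := by
  induction hn : u.length + v.length using Nat.strong_induction_on generalizing u v with
  | _ n ih =>
    wlog hle : u.length ≤ v.length generalizing u v
    · obtain ⟨z, r, s, hr, hs, h1, h2⟩ := this hv hu h.symm (by omega) (by omega)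
      exact ⟨z, s, r, hs, hr, h2, h1⟩
    have hpre : u <+: v :=
      List.prefix_of_prefix_length_le ⟨v, h⟩ ⟨u, rfl⟩ hle
    obtain ⟨t, rfl⟩ := hpre
    by_cases ht : t = []
    · exact ⟨u, 1, 1, le_rfl, le_rfl, by simp, by simp [ht]⟩
    · have hpos := List.length_pos_of_ne_nil hu
      rw [List.append_assoc, List.append_cancel_left_eq] at h
      obtain ⟨z, r, s, hr, hs, h1, h2⟩ := ih (u.length + t.length)
        (by simp at hn; omega) hu ht h rfl
      refine ⟨z, r, r + s, hr, by omega, h1, ?_⟩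
      rw [List.replicate_add, List.flatten_append, ← h1, ← h2]

section Lyndon

variable {X : Type*} [LinearOrder X]

theorem IsLyndon.lt_suffix {u v : List X} (hw : IsLyndon (u ++ v)) (hu : u ≠ []) (hv : v ≠ []) :
    u ++ v < v := by
  obtain ⟨-, hprim, hmin⟩ := hw
  have hupos := List.length_pos_of_ne_nil hu
  have hlt : u ++ v < v ++ u := by
    refine lt_of_le_of_ne (hmin _ ⟨v.length, by simp⟩) fun h => ?_
    obtain ⟨z, r, s, hr, hs, h1, h2⟩ := List.exists_replicate_flatten_of_append_comm hu hv h
    refine hprim z (r + s) (by omega) ?_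
    rw [List.replicate_add, List.flatten_append, ← h1, ← h2]
  by_contra hcon
  have hne : v ≠ u ++ v := fun h => by
    have := congrArg List.length h
    simp at this
    exact hu this
  have hvw : v < u ++ v := lt_of_le_of_ne (not_lt.1 hcon) hne
  rcases List.exists_append_or_forall_append_lt hvw with ⟨t, -, ht⟩ | h
  · have htu : t < u := by
      rw [ht] at hlt
      exact (List.append_lt_append_iff_left' v).1 hlt
    have hlen : u.length ≤ t.length := by
      have := congrArg List.length ht
      simp at this
      omega
    have h1 := List.append_lt_append_of_length_le htu hlen v v
    have h2 := hmin (t ++ v) ⟨t.length, by simp [ht]⟩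
    exact absurd h1 (not_lt.2 h2)
  · have := h u []
    rw [List.append_nil] at this
    exact absurd hlt this.asymm

/-- A nonempty word is Lyndon iff it is smaller than all its proper nonempty suffixes. -/
theorem isLyndon_iff {w : List X} :
    IsLyndon w ↔ w ≠ [] ∧ ∀ u v, u ≠ [] → v ≠ [] → w = u ++ v → w < v := by
  refine ⟨fun h => ⟨h.1, ?_⟩, fun ⟨hne, h⟩ => ⟨hne, ?_, ?_⟩⟩
  · rintro u v hu hv rfl
    exact h.lt_suffix hu hv
  · rintro u r hr rfl
    obtain ⟨k, rfl⟩ := Nat.exists_eq_add_of_le' hr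
    have hu : u ≠ [] := by
      rintro rfl
      simp at hne
    have := h (List.replicate (k + 1) u).flatten u (by simp [List.replicate_succ, hu]) hu
      (by rw [show k + 2 = (k + 1) + 1 from rfl, List.replicate_succ']; simp)
    rw [List.replicate_succ, List.flatten_cons] at this
    exact absurd this (not_lt.2 (List.le_append_right' _ _))
  · rintro v ⟨n, rfl⟩
    by_cases hv : v = []
    · simp [hv] at hne
    rcases eq_or_ne (n % v.length) 0 with h0 | h0
    · rw [← List.rotate_mod, h0, List.rotate_zero]
    rw [← List.rotate_mod] at h ⊢
    have hlt : n % v.length < v.length := Nat.mod_lt _ (List.length_pos_of_ne_nil hv)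
    rw [List.rotate_eq_drop_append_take hlt.le] at h ⊢
    have hA : v.drop (n % v.length) ≠ [] := by simpa using hlt
    have hB : v.take (n % v.length) ≠ [] := by simp [h0, hv]
    have h1 := h _ _ hA hB rfl
    have h2 := List.le_append_right' (v.take (n % v.length)) (v.drop (n % v.length))
    rw [List.take_append_drop] at h2
    exact (h1.trans_le h2).le

theorem isLyndon_singleton (x : X) : IsLyndon [x] := by
  refine isLyndon_iff.2 ⟨by simp, fun u v hu hv h => ?_⟩
  have := List.length_pos_of_ne_nil hu
  have := List.length_pos_of_ne_nil hv
  have := congrArg List.length h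
  simp at this
  omega

theorem IsLyndon.append {u v : List X} (hu : IsLyndon u) (hv : IsLyndon v) (huv : u < v) :
    IsLyndon (u ++ v) := by
  have hlt : u ++ v < v := by
    rcases List.exists_append_or_forall_append_lt huv with ⟨t, ht, rfl⟩ | h
    · exact (List.append_lt_append_iff_left' u).2 (hv.lt_suffix hu.1 ht)
    · simpa using h v []
  refine isLyndon_iff.2 ⟨by simp [hu.1], fun p s hp hs h => ?_⟩
  rcases List.append_eq_append_iff.1 h with ⟨t, rfl, rfl⟩ | ⟨t, rfl, rfl⟩
  · by_cases ht : t = []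
    · simpa [ht] using hlt
    · exact hlt.trans (hv.lt_suffix ht hs)
  · by_cases ht : t = []
    · simpa [ht] using hlt
    · have h1 := hu.lt_suffix hp ht
      exact List.append_lt_append_of_length_le h1 (by simp) _ _

/-- Existence part of the Chen–Fox–Lyndon theorem. -/
theorem exists_lyndon_factorization (w : List X) :
    ∃ L : List (List X), L.Pairwise (· ≥ ·) ∧ (∀ l ∈ L, IsLyndon l) ∧ L.flatten = w := by
  classical
  have hex : ∃ n, ∃ L : List (List X), L.length = n ∧ (∀ l ∈ L, IsLyndon l) ∧ L.flatten = w := by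
    refine ⟨_, w.map fun x => [x], rfl, ?_, ?_⟩
    · simp only [List.mem_map]
      rintro _ ⟨x, -, rfl⟩
      exact isLyndon_singleton x
    · induction w with
      | nil => rfl
      | cons x w ih => simp [ih]
  obtain ⟨L, hlen, hL, hw⟩ := Nat.find_spec hex
  refine ⟨L, ?_, hL, hw⟩
  rw [← List.isChain_iff_pairwise, List.isChain_iff_forall_rel_of_append_cons_cons]
  rintro a b p q rfl
  by_contra hab
  have hab : a < b := not_le.1 hab
  refine Nat.find_min hex (m := (p ++ (a ++ b) :: q).length) ?_ ⟨_, rfl, ?_, ?_⟩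
  · rw [← hlen]
    simp
  · intro l hl
    simp only [List.mem_append, List.mem_cons] at hl hL
    rcases hl with hl | rfl | hl
    · exact hL _ (Or.inl hl)
    · exact (hL a (by simp)).append (hL b (by simp)) hab
    · exact hL _ (by simp [hl])
  · rw [← hw]
    simp

/-- A nonempty prefix of a concatenation of words, all bounded above by `b`, has a nonempty suffix
bounded above by `b`. -/
theorem exists_suffix_le_of_prefix_flatten {b : List X} {L : List (List X)} (hL : ∀ l ∈ L, l ≤ b)
    {p : List X} (hp : p ≠ []) (h : p <+: L.flatten) :
    ∃ u v, v ≠ [] ∧ p = u ++ v ∧ v ≤ b := by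
  induction L generalizing p with
  | nil => simp at h; exact absurd h hp
  | cons l L ih =>
    rw [List.flatten_cons] at h
    by_cases hle : p.length ≤ l.length
    · obtain ⟨t, rfl⟩ := List.prefix_of_prefix_length_le h (List.prefix_append _ _) hle
      exact ⟨[], p, hp, rfl, (List.le_append_right' p t).trans (hL _ (by simp))⟩
    · obtain ⟨t, rfl⟩ :=
        List.prefix_of_prefix_length_le (List.prefix_append _ _) h (not_le.1 hle).le
      have ht : t ≠ [] := by rintro rfl; simp at hle
      obtain ⟨u, v, hv, rfl, hvb⟩ := ih (fun l hl => hL l (by simp [hl])) ht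
        ((List.prefix_append_right_inj l).1 h)
      exact ⟨l ++ u, v, hv, by simp, hvb⟩

/-- In a nonincreasing factorization into Lyndon words, the first factor is at least as long as
every Lyndon prefix. -/
theorem IsLyndon.length_le_of_prefix {l : List X} {L : List (List X)}
    (hs : (l :: L).Pairwise (· ≥ ·)) {p : List X} (hp : IsLyndon p)
    (h : p <+: (l :: L).flatten) : p.length ≤ l.length := by
  by_contra hlt
  rw [List.flatten_cons] at h
  obtain ⟨t, rfl⟩ := List.prefix_of_prefix_length_le (List.prefix_append _ _) h (not_le.1 hlt).le
  have ht : t ≠ [] := by rintro rfl; simp at hlt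
  obtain ⟨u, v, hv, rfl, hvl⟩ := exists_suffix_le_of_prefix_flatten
    (fun l' hl' => (List.pairwise_cons.1 hs).1 l' hl') ht ((List.prefix_append_right_inj l).1 h)
  have hlpos : l ++ (u ++ v) ≤ v := by
    by_cases hlu : l ++ u = []
    · simp at hlu
      simp [hlu]
    · rw [← List.append_assoc] at hp ⊢
      exact (hp.lt_suffix hlu hv).le
  exact absurd (List.lt_append_of_ne_nil l ht) (not_lt.2 (hlpos.trans hvl))

/-- Uniqueness of the first factor in the Chen–Fox–Lyndon theorem. -/
theorem lyndon_factorization_head_unique {l l' : List X} {L L' : List (List X)}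
    (hs : (l :: L).Pairwise (· ≥ ·)) (hs' : (l' :: L').Pairwise (· ≥ ·))
    (hl : IsLyndon l) (hl' : IsLyndon l') (h : (l :: L).flatten = (l' :: L').flatten) :
    l = l' := by
  have h1 : l <+: (l :: L).flatten := by simp
  have h2 : l' <+: (l' :: L').flatten := by simp
  have hle := hl.length_le_of_prefix hs' (h ▸ h1)
  have hle' := hl'.length_le_of_prefix hs (h ▸ h2)
  exact (List.prefix_of_prefix_length_le h1 (h ▸ h2) hle).eq_of_length (le_antisymm hle hle')

end Lyndon

section LyndonSpan

variable {X : Type*} [LinearOrder X]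

/-- The concatenations of nonincreasing sequences of words from `F`. -/
def nonincreasingProducts (F : Set (List X)) : Set (List X) :=
  {w | ∃ L : List (List X), L.Pairwise (· ≥ ·) ∧ (∀ l ∈ L, l ∈ F) ∧ L.flatten = w}

theorem nonincreasingProducts_empty : nonincreasingProducts (∅ : Set (List X)) = {[]} := by
  ext w
  constructor
  · rintro ⟨L, -, h, rfl⟩
    rw [List.eq_nil_iff_forall_not_mem.2 h]
    rfl
  · rintro rfl
    exact ⟨[], List.Pairwise.nil, by simp, rfl⟩

theorem nonincreasingProducts_insert {F : Set (List X)} {a : List X} (ha : ∀ l ∈ F, l < a) :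
    nonincreasingProducts (insert a F) =
      nonincreasingProducts F ∪ (a ++ ·) '' nonincreasingProducts (insert a F) := by
  ext w
  constructor
  · rintro ⟨L, hs, hL, rfl⟩
    rcases L with _ | ⟨l, L⟩
    · exact Or.inl ⟨[], List.Pairwise.nil, by simp, rfl⟩
    rcases hL l (by simp) with rfl | hl
    · exact Or.inr ⟨L.flatten, ⟨L, hs.of_cons, fun l' hl' => hL l' (by simp [hl']), rfl⟩, by simp⟩
    · refine Or.inl ⟨l :: L, hs, fun l' hl' => ?_, rfl⟩
      rcases hL l' hl' with rfl | h
      · rcases List.mem_cons.1 hl' with rfl | h'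
        · exact hl
        · exact absurd (ha l hl) (not_lt.2 ((List.pairwise_cons.1 hs).1 _ h'))
      · exact h
  · rintro (⟨L, hs, hL, rfl⟩ | ⟨_, ⟨L, hs, hL, rfl⟩, rfl⟩)
    · exact ⟨L, hs, fun l hl => Or.inr (hL l hl), rfl⟩
    · refine ⟨a :: L, List.pairwise_cons.2 ⟨fun l hl => ?_, hs⟩, ?_, by simp⟩
      · rcases hL l hl with rfl | h
        · exact le_rfl
        · exact (ha l h).le
      · rintro l (_ | ⟨_, hl⟩)
        · exact Or.inl rfl
        · exact hL l hl

theorem disjoint_nonincreasingProducts_append {F : Set (List X)} {a : List X}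
    (ha : ∀ l ∈ F, l < a) (hF : ∀ l ∈ F, IsLyndon l) (haL : IsLyndon a) :
    Disjoint (nonincreasingProducts F)
      ((a ++ ·) '' nonincreasingProducts (insert a F)) := by
  rw [Set.disjoint_left]
  rintro w ⟨L, hs, hL, rfl⟩ ⟨_, ⟨L', hs', hL', rfl⟩, h⟩
  rcases L with _ | ⟨l, L⟩
  · exact haL.1 (List.append_eq_nil_iff.1 h).1
  have hl := hL l (by simp)
  have hs'' : (a :: L').Pairwise (· ≥ ·) := by
    refine List.pairwise_cons.2 ⟨fun l hl => ?_, hs'⟩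
    rcases hL' l hl with rfl | h
    · exact le_rfl
    · exact (ha l h).le
  have := lyndon_factorization_head_unique hs'' hs haL (hF l hl) (by simpa using h)
  exact absurd (ha l hl) (by simp [this])

end LyndonSpan

section Words

variable {X R : Type*}

theorem sum_prod_map_le [Fintype X] (f : X → ℝ) (hf : ∀ p, 0 ≤ f p) (hq : ∑ p, f p < 1)
    (s : Finset (List X)) : ∑ w ∈ s, (w.map f).prod ≤ (1 - ∑ p, f p)⁻¹ := by
  classical
  have hnn : ∀ w : List X, 0 ≤ (w.map f).prod := fun w =>
    List.prod_nonneg (by simp only [List.mem_map]; rintro _ ⟨p, -, rfl⟩; exact hf p)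
  have hq0 : 0 ≤ ∑ p, f p := Finset.sum_nonneg fun p _ => hf p
  have key : ∀ (N : ℕ) (s : Finset (List X)), (∀ w ∈ s, w.length ≤ N) →
      ∑ w ∈ s, (w.map f).prod ≤ (1 - ∑ p, f p)⁻¹ := by
    intro N
    induction N with
    | zero =>
      intro s hs
      calc ∑ w ∈ s, (w.map f).prod ≤ ∑ w ∈ {[]}, (w.map f).prod :=
            Finset.sum_le_sum_of_subset_of_nonneg
              (fun w hw => by simpa using hs w hw) fun w _ _ => hnn w
        _ = 1 := by simp
        _ ≤ _ := by rw [one_le_inv₀ (by linarith)]; linarith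
    | succ N ih =>
      intro s hs
      set t : Finset (List X) := s.image List.tail with ht
      have htN : ∀ w ∈ t, w.length ≤ N := by
        intro w hw
        obtain ⟨v, hv, rfl⟩ := Finset.mem_image.1 hw
        have := hs v hv
        simp
        omega
      have hinj : Set.InjOn (fun p : X × List X => p.1 :: p.2)
          ((Finset.univ ×ˢ t : Finset (X × List X)) : Set (X × List X)) := by
        rintro ⟨a, b⟩ - ⟨c, d⟩ - h
        simpa using h
      calc ∑ w ∈ s, (w.map f).prod
          ≤ ∑ w ∈ insert [] ((Finset.univ ×ˢ t).image fun p : X × List X => p.1 :: p.2),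
              (w.map f).prod := by
            refine Finset.sum_le_sum_of_subset_of_nonneg (fun w hw => ?_) fun w _ _ => hnn w
            rcases w with _ | ⟨x, w⟩
            · simp
            · refine Finset.mem_insert_of_mem (Finset.mem_image.2 ⟨(x, w), ?_, rfl⟩)
              exact Finset.mem_product.2 ⟨Finset.mem_univ _, Finset.mem_image.2 ⟨_, hw, rfl⟩⟩
        _ = 1 + (∑ p, f p) * ∑ w ∈ t, (w.map f).prod := by
            rw [Finset.sum_insert (by simp), Finset.sum_image hinj, Finset.sum_product,
              Finset.sum_mul_sum]
            simp
        _ ≤ 1 + (∑ p, f p) * (1 - ∑ p, f p)⁻¹ := by gcongr; exact ih t htN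
        _ = (1 - ∑ p, f p)⁻¹ := by
            have : 1 - ∑ p, f p ≠ 0 := by linarith
            field_simp
            ring
  exact key (s.sup List.length) s fun w hw => Finset.le_sup (f := List.length) hw

variable [NormedRing R]

theorem norm_prod_map_le_mul (x : X → R) (w : List X) :
    ‖(w.map x).prod‖ ≤ ‖(1 : R)‖ * (w.map fun p => ‖x p‖).prod := by
  induction w using List.reverseRecOn with
  | nil => simp
  | append_singleton w p ih =>
    simp only [List.map_append, List.prod_append, List.map_singleton, List.prod_singleton]
    rw [← mul_assoc]
    exact (norm_mul_le _ _).trans (by gcongr)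

variable [Fintype X]

theorem summable_prod_map_norm {x : X → R} (hx : ∑ p, ‖x p‖ < 1) :
    Summable fun w : List X => ‖(1 : R)‖ * (w.map fun p => ‖x p‖).prod :=
  (summable_of_sum_le
    (fun w => List.prod_nonneg (by
      simp only [List.mem_map]; rintro _ ⟨p, -, rfl⟩; exact norm_nonneg _))
    (sum_prod_map_le _ (fun p => norm_nonneg _) hx)).mul_left _

variable [CompleteSpace R]

theorem summable_prod_map {x : X → R} (hx : ∑ p, ‖x p‖ < 1) :
    Summable fun w : List X => (w.map x).prod :=
  (summable_prod_map_norm hx).of_norm_bounded (norm_prod_map_le_mul x)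

/-- The geometric series in noncommuting variables. -/
theorem one_sub_sum_mul_tsum_words {x : X → R} (hx : ∑ p, ‖x p‖ < 1) :
    (1 - ∑ p, x p) * ∑' w : List X, (w.map x).prod = 1 := by
  have hs := summable_prod_map hx
  have hinj : Function.Injective fun p : X × List X => p.1 :: p.2 := by
    rintro ⟨a, b⟩ ⟨c, d⟩ h
    simpa using h
  have hcompl : (Set.range fun p : X × List X => p.1 :: p.2)ᶜ = {[]} := by
    ext w
    rcases w with _ | ⟨x, w⟩ <;> simp
  have h1 := Summable.tsum_add_tsum_compl (f := fun w : List X => (w.map x).prod)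
    (s := Set.range fun p : X × List X => p.1 :: p.2) (hs.subtype _) (hs.subtype _)
  rw [hcompl, tsum_range (fun w : List X => (w.map x).prod) hinj] at h1
  have h2 : ∑' p : X × List X, ((p.1 :: p.2).map x).prod =
      (∑ p, x p) * ∑' w : List X, (w.map x).prod := by
    rw [Summable.tsum_prod (f := fun p : X × List X => ((p.1 :: p.2).map x).prod)
      (hs.comp_injective hinj), tsum_fintype, Finset.sum_mul]
    refine Finset.sum_congr rfl fun p _ => ?_
    simp only [List.map_cons, List.prod_cons]
    exact hs.tsum_mul_left _
  rw [h2] at h1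
  simp at h1
  rw [sub_mul, one_mul]
  nth_rewrite 1 [← h1]
  simp

variable [LinearOrder X]

/-- Multiplying the sum over all words built from finitely many Lyndon words by the increasing
product of the factors `1 - l` gives `1`. -/
theorem prod_one_sub_mul_tsum_nonincreasingProducts {x : X → R} (hx : ∑ p, ‖x p‖ < 1)
    (L : List (List X)) (hs : L.Pairwise (· < ·)) (hL : ∀ l ∈ L, IsLyndon l) :
    (L.map fun l => 1 - (l.map x).prod).prod *
      ∑' w : nonincreasingProducts {l | l ∈ L}, (w.1.map x).prod = 1 := by
  have hsum := summable_prod_map hx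
  induction L using List.reverseRecOn with
  | nil =>
    have : {l : List X | l ∈ ([] : List (List X))} = ∅ := by simp
    rw [this, nonincreasingProducts_empty]
    simp
  | append_singleton L a ih =>
    rw [List.pairwise_append] at hs
    have ha : ∀ l ∈ {l | l ∈ L}, l < a := fun l hl => hs.2.2 l hl a (by simp)
    have hset : {l | l ∈ L ++ [a]} = insert a {l | l ∈ L} := by
      ext l
      simp [or_comm]
    have hF : ∀ l ∈ {l | l ∈ L}, IsLyndon l := fun l hl => hL l (List.mem_append_left _ hl)
    have h1 := Summable.tsum_union_disjoint (f := fun w : List X => (w.map x).prod)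
      (disjoint_nonincreasingProducts_append ha hF (hL a (by simp)))
      (hsum.subtype _) (hsum.subtype _)
    rw [← nonincreasingProducts_insert ha,
      tsum_image (fun w : List X => (w.map x).prod) (List.append_right_injective a).injOn] at h1
    simp only [List.map_append, List.prod_append] at h1
    rw [Summable.tsum_mul_left (f := fun w : nonincreasingProducts (insert a {l | l ∈ L}) =>
      (w.1.map x).prod) (a.map x).prod (hsum.subtype _)] at h1
    rw [hset, List.map_append, List.prod_append, mul_assoc, List.map_singleton,
      List.prod_singleton, sub_mul, one_mul]
    nth_rewrite 1 [h1]
    rw [add_sub_cancel_right]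
    exact ih hs.1 hF

/-- The factorization of `1 - ∑ x` over the Lyndon words in a set outside of which the Lyndon words
evaluate to `0`. -/
theorem hasIncreasingProd_lyndon {x : X → R} (hx : ∑ p, ‖x p‖ < 1) {P : List X → Prop}
    (hP : ∀ l, ¬ P l → (l.map x).prod = 0) :
    HasIncreasingProd (fun l : {w : List X // IsLyndon w ∧ P w} => 1 - (l.1.map x).prod)
      (1 - ∑ p, x p) := by
  classical
  let S (s : Finset {w : List X // IsLyndon w ∧ P w}) : R :=
    ∑' w : nonincreasingProducts {l | l ∈ (s.sort (· ≤ ·)).map Subtype.val}, (w.1.map x).prod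
  have hprod : ∀ s : Finset {w : List X // IsLyndon w ∧ P w},
      ((s.sort (· ≤ ·)).map fun l => 1 - (l.1.map x).prod).prod * S s = 1 := by
    intro s
    have := prod_one_sub_mul_tsum_nonincreasingProducts hx ((s.sort (· ≤ ·)).map Subtype.val)
      (List.pairwise_map.2 (Finset.sortedLT_sort s).pairwise)
      (by
        intro l hl
        obtain ⟨l, -, rfl⟩ := List.mem_map.1 hl
        exact l.2.1)
    rwa [List.map_map] at this
  have hlim : Tendsto S atTop (𝓝 (∑' w : List X, (w.map x).prod)) := by
    have hS : S = fun s => ∑' w : List X,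
        (nonincreasingProducts {l | l ∈ (s.sort (· ≤ ·)).map Subtype.val}).indicator
          (fun w => (w.map x).prod) w := funext fun s =>
      tsum_subtype (nonincreasingProducts {l | l ∈ (s.sort (· ≤ ·)).map Subtype.val})
        fun w => (w.map x).prod
    rw [hS]
    refine tendsto_tsum_of_dominated_convergence (summable_prod_map_norm hx) (fun w => ?_)
      (Eventually.of_forall fun s w =>
        (norm_indicator_le_norm_self _ _).trans (norm_prod_map_le_mul x w))
    obtain ⟨L, hLs, hL, rfl⟩ := exists_lyndon_factorization w
    by_cases hLP : ∀ l ∈ L, P l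
    · refine tendsto_const_nhds.congr' ?_
      filter_upwards [eventually_ge_atTop
        (L.toFinset.subtype fun w => IsLyndon w ∧ P w)] with s hs
      have hmem : L.flatten ∈
          nonincreasingProducts {l | l ∈ (s.sort (· ≤ ·)).map Subtype.val} := by
        refine ⟨L, hLs, fun l hl => ?_, rfl⟩
        refine List.mem_map.2 ⟨⟨l, hL l hl, hLP l hl⟩, ?_, rfl⟩
        rw [Finset.mem_sort]
        exact hs (by simpa using hl)
      exact (Set.indicator_of_mem hmem fun w => (w.map x).prod).symm
    · push Not at hLP
      obtain ⟨l, hl, hlP⟩ := hLP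
      have h0 : (L.flatten.map x).prod = 0 := by
        obtain ⟨L₁, L₂, rfl⟩ := List.append_of_mem hl
        simp [hP l hlP]
      have : ∀ s : Finset {w : List X // IsLyndon w ∧ P w},
          (nonincreasingProducts {l | l ∈ (s.sort (· ≤ ·)).map Subtype.val}).indicator
            (fun w => (w.map x).prod) L.flatten = 0 := fun s =>
        Set.indicator_apply_eq_zero.2 fun _ => h0
      simp only [this, h0]
      exact tendsto_const_nhds
  have hnorm : ‖∑ p, x p‖ < 1 := (norm_sum_le _ _).trans_lt hx
  obtain ⟨u, hu⟩ := isUnit_one_sub_of_norm_lt_one hnorm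
  have huS : ∑' w : List X, (w.map x).prod = (u⁻¹ : Rˣ) := by
    rw [← one_mul (∑' w : List X, (w.map x).prod), ← u.inv_mul, mul_assoc, hu,
      one_sub_sum_mul_tsum_words hx, mul_one]
  rw [huS] at hlim
  have hinv : Tendsto (fun s => Ring.inverse (S s)) atTop (𝓝 (1 - ∑ p, x p)) := by
    have := (NormedRing.inverse_continuousAt u⁻¹).tendsto.comp hlim
    rwa [Ring.inverse_unit, inv_inv, hu] at this
  refine hinv.congr' ?_
  filter_upwards [hlim.eventually (Units.isOpen.mem_nhds (u⁻¹).isUnit)] with s hs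
  obtain ⟨v, hv⟩ := hs
  have h1 := hprod s
  rw [← hv] at h1 ⊢
  rw [Ring.inverse_unit]
  exact (Units.eq_inv_of_mul_eq_one_right h1).symm

end Words

section Matrix

variable {n : ℕ}

/-- The letter `(i, j)` evaluated as the matrix `a_{ij} E_{ij}`. -/
noncomputable def letterMatrix (A : Matrix (Fin n) (Fin n) ℍ[ℝ]) (p : PairAlphabet n) :
    Matrix (Fin n) (Fin n) ℍ[ℝ] :=
  Matrix.single (ofLex p).1 (ofLex p).2 (A (ofLex p).1 (ofLex p).2)

theorem sum_letterMatrix (A : Matrix (Fin n) (Fin n) ℍ[ℝ]) : ∑ p, letterMatrix A p = A := by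
  conv_rhs => rw [Matrix.matrix_eq_sum_single A]
  rw [← Fintype.sum_prod_type' fun i j => Matrix.single i j (A i j)]
  exact Fintype.sum_equiv ofLex _ _ fun p => rfl

theorem prod_letterMatrix_of_isConnectedWord (A : Matrix (Fin n) (Fin n) ℍ[ℝ])
    (p : PairAlphabet n) (w : List (PairAlphabet n)) (h : IsConnectedWord (p :: w)) :
    ((p :: w).map (letterMatrix A)).prod =
      Matrix.single (ofLex p).1 (ofLex ((p :: w).getLast (by simp))).2
        (wordEntry A (p :: w)) := by
  induction w generalizing p with
  | nil => simp [letterMatrix, wordEntry]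
  | cons q w ih =>
    rw [IsConnectedWord, List.isChain_cons_cons] at h
    rw [List.map_cons, List.prod_cons, ih q h.2, letterMatrix, ← h.1,
      Matrix.single_mul_single_same]
    simp [wordEntry]

theorem prod_letterMatrix_of_not_isConnectedWord (A : Matrix (Fin n) (Fin n) ℍ[ℝ])
    (w : List (PairAlphabet n)) (h : ¬ IsConnectedWord w) :
    (w.map (letterMatrix A)).prod = 0 := by
  induction w with
  | nil => exact absurd List.isChain_nil h
  | cons p w ih =>
    by_cases hw : IsConnectedWord w
    · rcases w with _ | ⟨q, w⟩
      · exact absurd (List.isChain_singleton p) h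
      · have hpq : (ofLex p).2 ≠ (ofLex q).1 := fun hpq =>
          h (List.isChain_cons_cons.2 ⟨hpq, hw⟩)
        rw [List.map_cons, List.prod_cons, prod_letterMatrix_of_isConnectedWord A q w hw,
          letterMatrix]
        exact Matrix.single_mul_single_of_ne (h := hpq) ..
    · rw [List.map_cons, List.prod_cons, ih hw, mul_zero]

theorem lyndonFactor_eq (A : Matrix (Fin n) (Fin n) ℍ[ℝ]) (l : ConnectedLyndonWord n) :
    lyndonFactor A l = 1 - (l.1.map (letterMatrix A)).prod := by
  obtain ⟨w, hw, hc⟩ := l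
  rcases w with _ | ⟨p, w⟩
  · exact absurd rfl hw.1
  · rw [lyndonFactor, prod_letterMatrix_of_isConnectedWord A p w hc]
    rfl

attribute [local instance] Matrix.linftyOpNormedRing

theorem norm_letterMatrix_le (A : Matrix (Fin n) (Fin n) ℍ[ℝ]) (p : PairAlphabet n) :
    ‖letterMatrix A p‖ ≤ ‖A (ofLex p).1 (ofLex p).2‖ := by
  rw [Matrix.linfty_opNorm_def, ← coe_nnnorm, NNReal.coe_le_coe]
  refine Finset.sup_le fun i _ => ?_
  by_cases hi : (ofLex p).1 = i
  · rw [Finset.sum_eq_single (ofLex p).2]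
    · simp [letterMatrix, hi]
    · intro j _ hj
      simp [letterMatrix, hj.symm]
    · simp
  · simp [letterMatrix, Matrix.single_apply_of_row_ne hi]

theorem completeSpace_linftyOp :
    @CompleteSpace (Matrix (Fin n) (Fin n) ℍ[ℝ])
      (Matrix.linftyOpNormedRing (n := Fin n) (α := ℍ[ℝ])).toPseudoMetricSpace.toUniformSpace :=
  inferInstanceAs (CompleteSpace (Fin n → Fin n → ℍ[ℝ]))

end Matrix

theorem proposition5p4 (m : ℕ) :
    ∃ ε : ℝ, 0 < ε ∧
      ∀ A : Matrix (Fin (2 * m)) (Fin (2 * m)) ℍ[ℝ], (∀ r s, ‖A r s‖ < ε) →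
        HasIncreasingProd (fun l : ConnectedLyndonWord (2 * m) => lyndonFactor A l) (1 - A) := by
  refine ⟨((2 * m : ℕ) * (2 * m : ℕ) + 1 : ℝ)⁻¹, by positivity, fun A hA => ?_⟩
  let := Matrix.linftyOpNormedRing (n := Fin (2 * m)) (α := ℍ[ℝ])
  have := completeSpace_linftyOp (n := 2 * m)
  have hx : ∑ p, ‖letterMatrix A p‖ < 1 := by
    calc ∑ p, ‖letterMatrix A p‖
        ≤ ∑ _p : PairAlphabet (2 * m), ((2 * m : ℕ) * (2 * m : ℕ) + 1 : ℝ)⁻¹ :=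
          Finset.sum_le_sum fun p _ => (norm_letterMatrix_le A p).trans (hA _ _).le
      _ = ((2 * m : ℕ) * (2 * m : ℕ) : ℝ) * ((2 * m : ℕ) * (2 * m : ℕ) + 1 : ℝ)⁻¹ := by
          rw [Finset.sum_const, nsmul_eq_mul, Finset.card_univ, Fintype.card_lex,
            Fintype.card_prod, Fintype.card_fin, Nat.cast_mul]
      _ < 1 := by
          rw [← div_eq_mul_inv, div_lt_one (by positivity)]
          exact lt_add_one _
  have h := hasIncreasingProd_lyndon hx (P := IsConnectedWord)
    fun l hl => prod_letterMatrix_of_not_isConnectedWord A l hl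
  rw [sum_letterMatrix] at h
  simp only [lyndonFactor_eq]
  exact h
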